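/- All graphs are finite and simple. Let $G$ be a graph. A path in $G$ is an induced path. For an integer $k\ge 1$ and distinct vertices $a,b$ of $G$, the pair $ab$ is a \emph{$k$-banana} in $G$ if $a$ and $b$ are non-adjacent and there are $k$ pairwise internally vertex-disjoint paths in $G$ from $a$ to $b$. A \emph{normal weight function} on $G$ is a function $w:V(G)\to\mathbb{R}_{\ge 0}$ with $\sum_{v\in V(G)}w(v)=1$; for $S\subseteq V(G)$ write $w(S)=\sum_{v\in S}w(v)$. A set $Y\subseteq V(G)$ is a \emph{$w$-balanced separator} of $G$ if $w(D)\le \frac12$ for every connected component $D$ of $G\setminus Y$. A clique is a (possibly empty) set of pairwise adjacent vertices, and $N[X]$ denotes the set of vertices that belong to $X$ or have a neighbor in $X$. \textbf{Theorem.} Let $L>0$ be an integer, let $G$ be a graph in which there is no $L$-banana, and let $w$ be a normal weight function on $G$. Then there is a clique $K$ in $G$ with the following property: for every $X\subseteq V(G)\setminus K$ such that $w(D)\le\frac12$ for every component $D$ of $G\setminus (K\cup N[X])$, there is a $w$-balanced separator $Y$ of $G$ with $|Y\setminus K|\le 3L|X|$. -/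

import Mathlib

namespace BananaGraph

/-- A normal weight function: nonnegative vertex weights of total weight one. -/
structure IsNormalWeight {V : Type*} [Fintype V] (w : V → ℝ) : Prop where
  nonneg : ∀ v, 0 ≤ w v
  sum_eq_one : ∑ v, w v = 1

/-- The total weight `w(S)` of a set `S` of vertices. -/
noncomputable def weight {V : Type*} [Fintype V] (w : V → ℝ) (S : Set V) : ℝ :=
  ∑ v, S.indicator w v

/-- The closed neighborhood `N[X]` of a set of vertices. -/
def closedNbhd {V : Type*} (G : SimpleGraph V) (X : Set V) : Set V :=
  X ∪ {v | ∃ x ∈ X, G.Adj x v}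

/-- `S` is a `(w, c)`-balanced separator: every component of `G ∖ S` has weight at most `c`. -/
def IsBalancedSeparator {V : Type*} [Fintype V] (G : SimpleGraph V) (w : V → ℝ) (c : ℝ)
    (S : Set V) : Prop :=
  ∀ D : (G.induce Sᶜ).ConnectedComponent, weight w (Subtype.val '' D.supp) ≤ c

/-- The walk `p` is an induced path: its vertices are distinct, and every edge of `G` between two
of its vertices is an edge of `p`. -/
def IsInducedPath {V : Type*} (G : SimpleGraph V) {a b : V} (p : G.Walk a b) : Prop :=
  p.IsPath ∧ ∀ x ∈ p.support, ∀ y ∈ p.support, G.Adj x y → s(x, y) ∈ p.edges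

/-- The vertices of `p` other than its two ends. -/
def interior {V : Type*} (G : SimpleGraph V) {a b : V} (p : G.Walk a b) : Set V :=
  {v | v ∈ p.support ∧ v ≠ a ∧ v ≠ b}

/-- `ab` is a `k`-banana: `a`, `b` are distinct and non-adjacent, and there are `k` pairwise
internally vertex-disjoint (induced) paths from `a` to `b`. Since `a`, `b` are distinct and
non-adjacent, interiors are nonempty, so that the `k` paths are automatically distinct. -/
def IsBanana {V : Type*} (G : SimpleGraph V) (k : ℕ) (a b : V) : Prop :=
  a ≠ b ∧ ¬ G.Adj a b ∧
    ∃ P : Fin k → G.Walk a b,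
      (∀ i, IsInducedPath G (P i)) ∧
      ∀ i j, i ≠ j → Disjoint (interior G (P i)) (interior G (P j))

end BananaGraph

/-!
The clique `K` consists of the vertices that fewer than `L` vertices cannot cut off from the heavy
part of `G`: every set `T` containing the vertex and having fewer than `L` outside neighbors has
weight more than `1 / 2`.

`K` is a clique: for distinct non-adjacent `a`, `b`, the absence of an `L`-banana gives, by
Menger's theorem (`exists_small_cut_of_not_isBanana`), a set `T` containing `a`, with fewer than `L`
outside neighbors, such that `b` lies neither in `T` nor among these neighbors. If `a` and `b` both
belonged to `K`, then `T` and the set of vertices beyond its boundary would be disjoint sets of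
weight more than `1 / 2` each.

If `X` misses `K`, then each `x ∈ X` lies in a set `T x` of weight at most `1 / 2` with fewer than
`L` outside neighbors. Adding all these boundaries to `K` gives `Y`. A component `D` of `G ∖ Y` of
weight more than `1 / 2` cannot meet any `T x`, since it would then lie inside it. Hence `D`
avoids `N[X]`, so it is contained in a component of `G ∖ (K ∪ N[X])`, which is too light.

Menger's theorem is derived from Hall's marriage theorem. Take `L` copies of a terminal together
with the vertices other than `a` and `b`. A permutation of this set that sends each terminal to a
neighbor of `a`, and each vertex to itself, to a neighbor, or (if it is adjacent to `b`) to a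
terminal, contains `L` disjoint routes from `a` to `b`: follow its cycles from one terminal to
the next. Hall's condition for the existence of this permutation says that every set separating
`a` from `b` has at least `L` vertices.
-/

namespace BananaGraph

open Set

variable {V : Type*}

/-! ### Outer boundaries -/

/-- The vertices outside `T` that have a neighbor in `T`. -/
def outerBoundary (G : SimpleGraph V) (T : Set V) : Set V :=
  {y | y ∉ T ∧ ∃ x ∈ T, G.Adj x y}

/-- Seen from the far side, the boundary can only shrink. -/
lemma outerBoundary_compl_union_subset (G : SimpleGraph V) (T : Set V) :
    outerBoundary G (T ∪ outerBoundary G T)ᶜ ⊆ outerBoundary G T := by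
  rintro y ⟨hy, x, hx, hxy⟩
  by_contra hyS
  have hyT : y ∈ T := by
    by_contra hyT
    exact hy fun h => h.elim hyT hyS
  have hxT : x ∉ T := fun h => hx (Or.inl h)
  exact hx (Or.inr ⟨hxT, y, hyT, hxy.symm⟩)

/-! ### Induced paths inside a set of vertices -/

/-- The graph on all of `V` that keeps the edges of `G` with both ends in `s`. -/
def restrict (G : SimpleGraph V) (s : Set V) : SimpleGraph V where
  Adj x y := G.Adj x y ∧ x ∈ s ∧ y ∈ s
  symm := ⟨fun _ _ h => ⟨h.1.symm, h.2.2, h.2.1⟩⟩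
  loopless := ⟨fun x h => G.loopless.irrefl x h.1⟩

lemma restrict_le (G : SimpleGraph V) (s : Set V) : restrict G s ≤ G := fun _ _ h => h.1

lemma mem_of_mem_support_restrict {G : SimpleGraph V} {s : Set V} {a b : V} (ha : a ∈ s)
    (p : (restrict G s).Walk a b) {x : V} (hx : x ∈ p.support) : x ∈ s := by
  induction p with
  | nil => simp_all
  | cons h p ih =>
    rcases List.mem_cons.1 hx with rfl | hx
    · exact ha
    · exact ih h.2.2 hx

/-- A geodesic has no chords. -/
lemma mem_edges_of_length_eq_dist {G : SimpleGraph V} {a b : V} {p : G.Walk a b}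
    (hp : p.length = G.dist a b) {x y : V} (hx : x ∈ p.support) (hy : y ∈ p.support)
    (hxy : G.Adj x y) : s(x, y) ∈ p.edges := by
  obtain ⟨i, rfl, hi⟩ := SimpleGraph.Walk.mem_support_iff_exists_getVert.1 hx
  obtain ⟨j, rfl, hj⟩ := SimpleGraph.Walk.mem_support_iff_exists_getVert.1 hy
  wlog hij : i < j generalizing i j
  · rcases (not_lt.1 hij).eq_or_lt with rfl | h
    · exact absurd hxy (G.loopless.irrefl _)
    · rw [Sym2.eq_swap]
      exact this j hj hy i hi hx hxy.symm h
  -- Replacing the stretch from `i` to `j` by the edge must not shorten the walk.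
  have h := SimpleGraph.dist_le ((p.take i).append (.cons hxy (p.drop j)))
  rw [← hp, SimpleGraph.Walk.length_append, SimpleGraph.Walk.length_cons,
    SimpleGraph.Walk.take_length, SimpleGraph.Walk.drop_length] at h
  obtain rfl : j = i + 1 := by omega
  exact (p.mk_mem_edges_iff_exists).2 ⟨i, by omega, rfl⟩

lemma exists_isInducedPath {G : SimpleGraph V} {s : Set V} {a b : V} (ha : a ∈ s)
    (h : (restrict G s).Reachable a b) :
    ∃ p : G.Walk a b, IsInducedPath G p ∧ ∀ x ∈ p.support, x ∈ s := by
  obtain ⟨p, hp⟩ := h.exists_walk_length_eq_dist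
  have hs : ∀ x ∈ p.support, x ∈ s := fun x hx => mem_of_mem_support_restrict ha p hx
  refine ⟨p.mapLe (restrict_le G s), ⟨?_, ?_⟩, ?_⟩
  · exact (p.isPath_of_length_eq_dist hp).mapLe _
  · intro x hx y hy hxy
    rw [SimpleGraph.Walk.support_mapLe_eq_support] at hx hy
    rw [SimpleGraph.Walk.edges_mapLe_eq_edges]
    exact mem_edges_of_length_eq_dist hp hx hy ⟨hxy, hs x hx, hs y hy⟩
  · intro x hx
    rw [SimpleGraph.Walk.support_mapLe_eq_support] at hx
    exact hs x hx

/-! ### Menger's theorem -/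

/-- The moves allowed to a permutation encoding `L` disjoint routes from `a` to `b`. An element
`inl i` is a terminal, standing for `a` when it is left and for `b` when it is entered; a vertex
that is on no route may stay put. -/
def LinkRel (G : SimpleGraph V) (L : ℕ) (a b : V) :
    Fin L ⊕ {v : V // v ≠ a ∧ v ≠ b} → Fin L ⊕ {v : V // v ≠ a ∧ v ≠ b} → Prop
  | .inl _, .inl _ => False
  | .inl _, .inr u => G.Adj a u
  | .inr v, .inr u => v = u ∨ G.Adj v u
  | .inr v, .inl _ => G.Adj v b

/-- Hall's theorem turns the absence of small cuts into a permutation following `LinkRel`. -/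
lemma exists_perm_linkRel [Fintype V] {G : SimpleGraph V} {L : ℕ} {a b : V} (hab : a ≠ b)
    (hadj : ¬ G.Adj a b)
    (hcut : ∀ T : Set V, a ∈ T → b ∉ T → b ∉ outerBoundary G T → L ≤ (outerBoundary G T).ncard) :
    ∃ e : Equiv.Perm (Fin L ⊕ {v : V // v ≠ a ∧ v ≠ b}), ∀ x, LinkRel G L a b x (e x) := by
  classical
  obtain ⟨f, hf, hr⟩ :=
    (Fintype.all_card_le_filter_rel_iff_exists_injective (LinkRel G L a b)).1 (by
      intro A
      set N : Finset (Fin L ⊕ {v : V // v ≠ a ∧ v ≠ b}) :=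
        {y | ∃ x ∈ A, LinkRel G L a b x y} with hN
      have hstay : ∀ v, Sum.inr v ∈ A → Sum.inr v ∈ N := fun v hv => by
        simp only [hN, Finset.mem_filter, Finset.mem_univ, true_and]
        exact ⟨_, hv, Or.inl rfl⟩
      by_cases hleft : ∃ i, Sum.inl i ∈ A
      swap
      · refine Finset.card_le_card fun x hx => ?_
        rcases x with i | v
        · exact absurd ⟨i, hx⟩ hleft
        · exact hstay v hx
      obtain ⟨i₀, hi₀⟩ := hleft
      by_cases hb : ∃ v, Sum.inr v ∈ A ∧ G.Adj v.1 b
      · obtain ⟨v, hv, hvb⟩ := hb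
        refine Finset.card_le_card fun x hx => ?_
        rcases x with i | u
        · simp only [hN, Finset.mem_filter, Finset.mem_univ, true_and]
          exact ⟨_, hv, hvb⟩
        · exact hstay u hx
      -- No vertex of `A` sees `b`, so `a` together with these vertices is cut off from `b`.
      set T : Set V := {x | x = a ∨ ∃ v, Sum.inr v ∈ A ∧ v.1 = x} with hT
      have hbT : b ∉ T := by
        rintro (h | ⟨v, -, h⟩)
        · exact hab h.symm
        · exact v.2.2 h
      have hbS : b ∉ outerBoundary G T := by
        rintro ⟨-, x, rfl | ⟨v, hv, rfl⟩, hxb⟩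
        · exact hadj hxb
        · exact hb ⟨v, hv, hxb⟩
      have hL := hcut T (Or.inl rfl) hbT hbS
      rw [Set.ncard_eq_toFinset_card'] at hL
      have hsub : A.toRight.map (Function.Embedding.subtype _) ∪ (outerBoundary G T).toFinset ⊆
          N.toRight.map (Function.Embedding.subtype _) := by
        intro y hy
        rcases Finset.mem_union.1 hy with hy | hy
        · obtain ⟨v, hv, rfl⟩ := Finset.mem_map.1 hy
          exact Finset.mem_map_of_mem _ (Finset.mem_toRight.2 (hstay v (Finset.mem_toRight.1 hv)))
        · rw [Set.mem_toFinset] at hy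
          have hya : y ≠ a := fun h => hy.1 (Or.inl h)
          have hyb : y ≠ b := fun h => hbS (h ▸ hy)
          refine Finset.mem_map.2 ⟨⟨y, hya, hyb⟩, Finset.mem_toRight.2 ?_, rfl⟩
          simp only [hN, Finset.mem_filter, Finset.mem_univ, true_and]
          obtain ⟨-, x, rfl | ⟨v, hv, rfl⟩, hxy⟩ := hy
          · exact ⟨_, hi₀, hxy⟩
          · exact ⟨_, hv, Or.inr hxy⟩
      have hdisj : Disjoint (A.toRight.map (Function.Embedding.subtype _))
          (outerBoundary G T).toFinset := by
        rw [Finset.disjoint_left]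
        intro y hy hyS
        obtain ⟨v, hv, rfl⟩ := Finset.mem_map.1 hy
        exact (Set.mem_toFinset.1 hyS).1 (Or.inr ⟨v, Finset.mem_toRight.1 hv, rfl⟩)
      have h₁ := Finset.card_le_card hsub
      rw [Finset.card_union_of_disjoint hdisj, Finset.card_map, Finset.card_map] at h₁
      have h₂ := A.card_toLeft_add_card_toRight
      have h₃ := N.card_toLeft_add_card_toRight
      have h₄ : A.toLeft.card ≤ L := by simpa using Finset.card_le_univ A.toLeft
      omega)
  exact ⟨Equiv.ofBijective f (Finite.injective_iff_bijective.1 hf), hr⟩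

/-- The vertices met when `e` is iterated from the terminal `i`, before the next terminal. -/
def route {L : ℕ} {a b : V} (e : Equiv.Perm (Fin L ⊕ {v : V // v ≠ a ∧ v ≠ b})) (i : Fin L) :
    Set V :=
  {x | ∃ v : {v : V // v ≠ a ∧ v ≠ b}, v.1 = x ∧ ∃ n, (e ^ n) (.inl i) = .inr v ∧
    ∀ m, 1 ≤ m → m ≤ n → ∀ j, (e ^ m) (.inl i) ≠ .inl j}

/-- Two orbits that meet before returning to a terminal start at the same terminal: running both
backwards from the meeting point, the shorter one reaches its terminal first. -/
lemma eq_of_pow_apply_inl_eq {α β : Type*} {e : Equiv.Perm (α ⊕ β)} {i j : α} {m n : ℕ}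
    (hmn : m ≤ n) (h : (e ^ m) (.inl i) = (e ^ n) (.inl j))
    (hn : ∀ k, 1 ≤ k → k ≤ n → ∀ l, (e ^ k) (.inl j) ≠ .inl l) : i = j := by
  obtain ⟨d, rfl⟩ := Nat.exists_eq_add_of_le hmn
  rw [pow_add, Equiv.Perm.mul_apply] at h
  have h' := (e ^ m).injective h
  rcases Nat.eq_zero_or_pos d with rfl | hd
  · simpa using h'
  · exact absurd h'.symm (hn d hd (by omega) i)

lemma disjoint_route {L : ℕ} {a b : V} (e : Equiv.Perm (Fin L ⊕ {v : V // v ≠ a ∧ v ≠ b}))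
    {i j : Fin L} (hij : i ≠ j) : Disjoint (route e i) (route e j) := by
  rw [Set.disjoint_left]
  rintro x ⟨v, rfl, m, hm, hm'⟩ ⟨u, huv, n, hn, hn'⟩
  obtain rfl := Subtype.ext huv
  rcases le_total m n with h | h
  · exact hij (eq_of_pow_apply_inl_eq h (hm.trans hn.symm) hn')
  · exact hij (eq_of_pow_apply_inl_eq h (hn.trans hm.symm) hm').symm

/-- The orbit of a terminal returns to a terminal because `e` has finite order; up to that moment it
is a walk from `a` to `b`. -/
lemma reachable_of_linkRel [Finite V] {G : SimpleGraph V} {L : ℕ} {a b : V}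
    {e : Equiv.Perm (Fin L ⊕ {v : V // v ≠ a ∧ v ≠ b})} (he : ∀ x, LinkRel G L a b x (e x))
    (i : Fin L) : (restrict G ({a, b} ∪ route e i)).Reachable a b := by
  classical
  have hret : ∃ n, 1 ≤ n ∧ ∃ j, (e ^ n) (.inl i) = .inl j :=
    ⟨orderOf e, orderOf_pos e, i, by rw [pow_orderOf_eq_one]; rfl⟩
  set N := Nat.find hret with hN
  obtain ⟨hN₁, j, hj⟩ := Nat.find_spec hret
  rw [← hN] at hN₁ hj
  have hbefore : ∀ m, 1 ≤ m → m < N → ∀ k, (e ^ m) (.inl i) ≠ .inl k := fun m hm hmN k hk =>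
    Nat.find_min hret hmN ⟨hm, k, hk⟩
  have hroute : ∀ n < N, ∀ v, (e ^ n) (.inl i) = .inr v → v.1 ∈ route e i := fun n hn v hv =>
    ⟨v, rfl, n, hv, fun m hm hmn => hbefore m hm (by omega)⟩
  have hreach : ∀ n < N, ∀ v, (e ^ n) (.inl i) = .inr v →
      (restrict G ({a, b} ∪ route e i)).Reachable a v.1 := by
    intro n
    induction n with
    | zero => intro _ v hv; simp at hv
    | succ n ih =>
      intro hn v hv
      have hstep := he ((e ^ n) (.inl i))
      rw [← Equiv.Perm.mul_apply, ← pow_succ', hv] at hstep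
      have hvr : v.1 ∈ ({a, b} ∪ route e i : Set V) := Or.inr (hroute _ hn v hv)
      rcases h : (e ^ n) (.inl i) with k | u
      · rw [h] at hstep
        exact SimpleGraph.Adj.reachable ⟨hstep, Or.inl (Or.inl rfl), hvr⟩
      · rw [h] at hstep
        have hu := ih (by omega) u h
        rcases hstep with rfl | hstep
        · exact hu
        · exact hu.trans
            (SimpleGraph.Adj.reachable ⟨hstep, Or.inr (hroute n (by omega) u h), hvr⟩)
  obtain ⟨n, hn⟩ : ∃ n, N = n + 1 := ⟨N - 1, by omega⟩
  have hstep := he ((e ^ n) (.inl i))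
  rw [← Equiv.Perm.mul_apply, ← pow_succ', ← hn, hj] at hstep
  rcases h : (e ^ n) (.inl i) with k | u
  · rw [h] at hstep
    exact hstep.elim
  · rw [h] at hstep
    exact (hreach n (by omega) u h).trans (SimpleGraph.Adj.reachable
      ⟨hstep, Or.inr (hroute n (by omega) u h), Or.inl (Or.inr rfl)⟩)

/-- Menger's theorem for two non-adjacent vertices: without `L` internally disjoint paths, some
fewer than `L` vertices separate them. -/
theorem exists_small_cut_of_not_isBanana [Fintype V] {G : SimpleGraph V} {L : ℕ} {a b : V}
    (hab : a ≠ b) (hadj : ¬ G.Adj a b) (hban : ¬ IsBanana G L a b) :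
    ∃ T : Set V, a ∈ T ∧ b ∉ T ∧ b ∉ outerBoundary G T ∧ (outerBoundary G T).ncard < L := by
  by_contra! hcut
  obtain ⟨e, he⟩ := exists_perm_linkRel hab hadj hcut
  choose P hP hsupp using fun i =>
    exists_isInducedPath (Set.mem_union_left _ (Set.mem_insert a _)) (reachable_of_linkRel he i)
  have hint : ∀ i, interior G (P i) ⊆ route e i := by
    rintro i x ⟨hx, hxa, hxb⟩
    rcases hsupp i x hx with (h | h) | h
    · exact absurd h hxa
    · exact absurd h hxb
    · exact h
  exact hban ⟨hab, hadj, P, hP, fun i j hij => (disjoint_route e hij).mono (hint i) (hint j)⟩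

/-! ### Weights and components -/

lemma weight_mono [Fintype V] {w : V → ℝ} (hw : ∀ v, 0 ≤ w v) {S T : Set V} (h : S ⊆ T) :
    weight w S ≤ weight w T :=
  Finset.sum_le_sum fun v _ => Set.indicator_le_indicator_of_subset h hw v

lemma weight_add_weight_le [Fintype V] {w : V → ℝ} (hw : IsNormalWeight w) {S T : Set V}
    (h : Disjoint S T) : weight w S + weight w T ≤ 1 := by
  rw [weight, weight, ← Finset.sum_add_distrib, ← hw.sum_eq_one]
  refine Finset.sum_le_sum fun v _ => ?_
  rw [← congrFun (Set.indicator_union_of_disjoint h w) v]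
  exact Set.indicator_le_self' (fun v _ => hw.nonneg v) v

/-- A component of `G ∖ Y` that meets a set whose boundary lies in `Y` is contained in it. -/
lemma supp_subset_of_outerBoundary_subset {G : SimpleGraph V} {Y T : Set V}
    (hT : outerBoundary G T ⊆ Y) (D : (G.induce Yᶜ).ConnectedComponent) {u : V}
    (hu : u ∈ Subtype.val '' D.supp) (huT : u ∈ T) : Subtype.val '' D.supp ⊆ T := by
  obtain ⟨u, hu, rfl⟩ := hu
  rintro _ ⟨v, hv, rfl⟩
  obtain ⟨p⟩ := SimpleGraph.ConnectedComponent.exact (hu.trans hv.symm)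
  clear hu hv
  induction p with
  | nil => exact huT
  | @cons x y z h p ih =>
    refine ih ?_
    by_contra hy
    exact y.2 (hT ⟨hy, x.1, huT, h⟩)

/-- A component of `G ∖ Y` that avoids `Z` is contained in a component of `G ∖ Z`. -/
lemma exists_supp_subset_supp {G : SimpleGraph V} {Y Z : Set V}
    (D : (G.induce Yᶜ).ConnectedComponent) (hD : ∀ v ∈ D.supp, v.1 ∉ Z) :
    ∃ D' : (G.induce Zᶜ).ConnectedComponent,
      (Subtype.val '' D.supp : Set V) ⊆ Subtype.val '' D'.supp := by
  obtain ⟨u, hu⟩ := D.nonempty_supp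
  refine ⟨(G.induce Zᶜ).connectedComponentMk ⟨u.1, hD u hu⟩, ?_⟩
  rintro _ ⟨v, hv, rfl⟩
  refine ⟨⟨v.1, hD v hv⟩, ?_, rfl⟩
  obtain ⟨p⟩ := SimpleGraph.ConnectedComponent.exact (hv.trans hu.symm)
  refine SimpleGraph.ConnectedComponent.sound ?_
  induction p with
  | nil => exact .rfl
  | @cons x y z h p ih =>
    have hy : y ∈ D.supp := (SimpleGraph.ConnectedComponent.sound h.reachable).symm.trans hv
    have hxy : (G.induce Zᶜ).Adj ⟨x.1, hD x hv⟩ ⟨y.1, hD y hy⟩ := h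
    exact hxy.reachable.trans (ih hu hy)

/-! ### The clique and the separator -/

/-- The vertices that cannot be cut off from more than half of the weight by fewer than `L`
vertices. -/
def heavyCore [Fintype V] (G : SimpleGraph V) (w : V → ℝ) (L : ℕ) : Set V :=
  {v | ∀ T : Set V, v ∈ T → (outerBoundary G T).ncard < L → 1 / 2 < weight w T}

lemma isClique_heavyCore [Fintype V] {G : SimpleGraph V} {w : V → ℝ} {L : ℕ}
    (hw : IsNormalWeight w) (hG : ∀ a b : V, ¬ IsBanana G L a b) :
    G.IsClique (heavyCore G w L) := by
  intro a ha b hb hab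
  by_contra hadj
  obtain ⟨T, haT, hbT, hbS, hlt⟩ := exists_small_cut_of_not_isBanana hab hadj (hG a b)
  have h₁ := ha T haT hlt
  have h₂ := hb (T ∪ outerBoundary G T)ᶜ (fun h => h.elim hbT hbS)
    ((Set.ncard_le_ncard (outerBoundary_compl_union_subset G T)).trans_lt hlt)
  have h₃ : Disjoint T (T ∪ outerBoundary G T)ᶜ :=
    disjoint_compl_right.mono_left Set.subset_union_left
  linarith [weight_add_weight_le hw h₃]

/-- The neighborhood of `X` in a balanced separator can be replaced by the boundaries of light sets
containing the vertices of `X`. -/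
lemma isBalancedSeparator_union_outerBoundary [Fintype V] {G : SimpleGraph V} {w : V → ℝ} {c : ℝ}
    (hw : ∀ v, 0 ≤ w v) {K X : Set V} {T : V → Set V} (hmem : ∀ x ∈ X, x ∈ T x)
    (hlight : ∀ x ∈ X, weight w (T x) ≤ c)
    (hX : IsBalancedSeparator G w c (K ∪ closedNbhd G X)) :
    IsBalancedSeparator G w c (K ∪ ⋃ x ∈ X, outerBoundary G (T x)) := by
  intro D
  have hsub : ∀ x ∈ X, outerBoundary G (T x) ⊆ K ∪ ⋃ x ∈ X, outerBoundary G (T x) := fun x hx =>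
    (Set.subset_biUnion_of_mem (u := fun x => outerBoundary G (T x)) hx).trans
      Set.subset_union_right
  by_cases hmeet : ∃ x ∈ X, ∃ v ∈ Subtype.val '' D.supp, v ∈ T x
  · obtain ⟨x, hx, v, hv, hvT⟩ := hmeet
    exact (weight_mono hw (supp_subset_of_outerBoundary_subset (hsub x hx) D hv hvT)).trans
      (hlight x hx)
  · obtain ⟨D', hD'⟩ := exists_supp_subset_supp (Z := K ∪ closedNbhd G X) D (by
      rintro v hv (hvK | hvX | ⟨x, hx, hxv⟩)
      · exact v.2 (Or.inl hvK)
      · exact hmeet ⟨v, hvX, v, ⟨v, hv, rfl⟩, hmem v hvX⟩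
      · have hvT : v.1 ∉ T x := fun h => hmeet ⟨x, hx, v, ⟨v, hv, rfl⟩, h⟩
        exact v.2 (hsub x hx ⟨hvT, x, hmem x hx, hxv⟩))
    exact (weight_mono hw hD').trans (hX D')

lemma ncard_biUnion_le_mul {X : Set V} (hX : X.Finite) {S : V → Set V} {L : ℕ}
    (hS : ∀ x ∈ X, (S x).ncard ≤ L) : (⋃ x ∈ X, S x).ncard ≤ L * X.ncard := by
  induction X, hX using Set.Finite.induction_on with
  | empty => simp
  | @insert x X hx hfin ih =>
    rw [Set.biUnion_insert, Set.ncard_insert_of_notMem hx hfin, Nat.mul_succ, Nat.add_comm]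
    exact (Set.ncard_union_le _ _).trans (add_le_add (hS x (Set.mem_insert _ _))
      (ih fun y hy => hS y (Set.mem_insert_of_mem _ hy)))

end BananaGraph

theorem mainTheorem4 {V : Type*} [Fintype V] (L : ℕ) (hL : 0 < L) (G : SimpleGraph V)
    (w : V → ℝ) (hw : BananaGraph.IsNormalWeight w)
    (hG : ∀ a b : V, ¬ BananaGraph.IsBanana G L a b) :
    ∃ K : Set V, G.IsClique K ∧
      ∀ X : Set V, Disjoint X K →
        BananaGraph.IsBalancedSeparator G w (1 / 2) (K ∪ BananaGraph.closedNbhd G X) →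
        ∃ Y : Set V, BananaGraph.IsBalancedSeparator G w (1 / 2) Y ∧
          (Y \ K).ncard ≤ 3 * L * X.ncard := by
  refine ⟨BananaGraph.heavyCore G w L, BananaGraph.isClique_heavyCore hw hG, fun X hXK hX => ?_⟩
  have hcut : ∀ x, ∃ T : Set V, x ∈ X → x ∈ T ∧ (BananaGraph.outerBoundary G T).ncard < L ∧
      BananaGraph.weight w T ≤ 1 / 2 := by
    intro x
    by_cases hx : x ∈ X
    · have h := Set.disjoint_left.1 hXK hx
      simp only [BananaGraph.heavyCore, Set.mem_ofPred_eq, not_forall, not_lt] at h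
      obtain ⟨T, h₁, h₂, h₃⟩ := h
      exact ⟨T, fun _ => ⟨h₁, h₂, h₃⟩⟩
    · exact ⟨∅, fun h => absurd h hx⟩
  choose T hT using hcut
  refine ⟨_, BananaGraph.isBalancedSeparator_union_outerBoundary hw.nonneg
    (fun x hx => (hT x hx).1) (fun x hx => (hT x hx).2.2) hX, ?_⟩
  calc _ ≤ (⋃ x ∈ X, BananaGraph.outerBoundary G (T x)).ncard :=
        Set.ncard_le_ncard (Set.union_sdiff_left.trans_subset Set.sdiff_subset)
    _ ≤ L * X.ncard :=
        BananaGraph.ncard_biUnion_le_mul X.toFinite fun x hx => (hT x hx).2.1.le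
    _ ≤ 3 * L * X.ncard := Nat.mul_le_mul_right _ (by omega)
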